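/- A graphon is a pair $\mathcal W=(W,(S,\mathcal S,\mu))$, where $(S,\mathcal S,\mu)$ is a $\sigma$-finite measure space with $\mu(S)>0$ and $W\colon S\times S\to\mathbb R$ is symmetric, $\mathcal S\times\mathcal S$-measurable and integrable with respect to $\mu\times\mu$. For graphons $\mathcal W_i=(W_i,(S_i,\mathcal S_i,\mu_i))$, $i=1,2$, with $\mu_1(S_1)=\mu_2(S_2)$, the cut distance is \[ \delta_\square(\mathcal W_1,\mathcal W_2)=\inf_\nu\ \sup_{U,V}\left|\int_{U\times V}\bigl(W_1(x_1,y_1)-W_2(x_2,y_2)\bigr)\,d\nu(x_1,x_2)\,d\nu(y_1,y_2)\right|, \] where the infimum is over all couplings $\nu$ of $\mu_1$ and $\mu_2$ (measures on $S_1\times S_2$ with marginals $\mu_1,\mu_2$) and the supremum is over measurable $U,V\subseteq S_1\times S_2$. If $\mu_1(S_1)\ne\mu_2(S_2)$, one first extends both spaces to $\sigma$-finite measure spaces of equal total mass (for instance, by attaching to each a disjoint copy of $[0,\infty)$ with Lebesgue measure) and extends $W_1,W_2$ by $0$; the value does not depend on the choice of the extensions. The stretched cut distance is $\delta^s_\square(\mathcal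 W_1,\mathcal W_2)=\delta_\square(\widehat{\mathcal W}_1,\widehat{\mathcal W}_2)$, where $\widehat{\mathcal W}_i$ is obtained from $\mathcal W_i$ by replacing $\mu_i$ with $\|W_i\|_1^{-1/2}\mu_i$ (and $\widehat{\mathcal W}_i=(0,(S_i,\mathcal S_i,\mu_i))$ if $\|W_i\|_1=0$). A finite simple graph $G$ with vertices $v_1,\dots,v_N$ is identified with the graphon over $[0,\infty)$ with Lebesgue measure whose value at $(x,y)$ is $1$ if $x\in[i-1,i)$ and $y\in[j-1,j)$ for some $i,j$ with $v_iv_j\in E(G)$, and $0$ otherwise (the choice of the ordering does not affect $\delta^s_\square$). Proposition. Let $(G_n)_{n\in\mathbb N}$ be a sequence of finite simple graphs such that the number of isolated vertices of $G_n$ is $o(|E(G_n)|)$ and $\lim_{n\to\infty}|E(G_n)|=\infty$. If there is a graphon $\mathcal W$ such that $\lim_{n\to\infty}\delta^s_\square(G_n,\mathcal W)=0$, then the average degrees $2|E(G_n)|/|V(G_n)|$ of the graphs $G_n$ are unbounded in $n$. -/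

import Mathlib

open MeasureTheory Filter Topology
open scoped ENNReal

universe u v

noncomputable section

/-- A graphon: a symmetric, measurable, integrable real function `W` on `S × S`, together with the
σ-finite measure space `(S, μ)` of positive total mass over which it is defined. -/
structure Graphon where
  S : Type u
  [mS : MeasurableSpace S]
  μ : Measure S
  [sigmaFinite : SigmaFinite μ]
  mass_ne_zero : μ Set.univ ≠ 0
  W : S → S → ℝ
  symm : ∀ x y, W x y = W y x
  measurable : Measurable (Function.uncurry W)
  integrable : Integrable (Function.uncurry W) (μ.prod μ)

attribute [instance] Graphon.mS Graphon.sigmaFinite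

/-- The cut norm `sup_{U, V} |∫_{U × V} F d(μ × μ)|` over measurable sets `U`, `V`. -/
def cutNorm {T : Type*} [MeasurableSpace T] (μ : Measure T) (F : T → T → ℝ) : ℝ≥0∞ :=
  ⨆ (U : Set T) (V : Set T) (_ : MeasurableSet U) (_ : MeasurableSet V),
    ENNReal.ofReal |∫ p in U ×ˢ V, F p.1 p.2 ∂(μ.prod μ)|

/-- `ν` is a coupling of `μ₁` and `μ₂`: a measure on the product with these marginals. -/
def IsCoupling {S₁ S₂ : Type*} [MeasurableSpace S₁] [MeasurableSpace S₂]
    (μ₁ : Measure S₁) (μ₂ : Measure S₂) (ν : Measure (S₁ × S₂)) : Prop :=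
  (∀ U, MeasurableSet U → ν (U ×ˢ Set.univ) = μ₁ U) ∧
    ∀ U, MeasurableSet U → ν (Set.univ ×ˢ U) = μ₂ U

/-- The half-line `[0, ∞)`, with its Borel σ-algebra. -/
abbrev HalfLine : Type := Set.Ici (0 : ℝ)

/-- Lebesgue measure on the half-line. -/
def lebHalfLine : Measure HalfLine := (volume : Measure ℝ).comap Subtype.val

lemma measurableEmbedding_halfLine : MeasurableEmbedding (Subtype.val : HalfLine → ℝ) :=
  MeasurableEmbedding.subtype_coe measurableSet_Ici

lemma lebHalfLine_univ : lebHalfLine Set.univ = ∞ := by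
  rw [lebHalfLine, measurableEmbedding_halfLine.comap_apply, Set.image_univ,
    Subtype.range_coe]
  exact Real.volume_Ici

instance : SigmaFinite lebHalfLine := by
  refine SigmaFinite.of_map lebHalfLine measurable_subtype_coe.aemeasurable ?_
  rw [lebHalfLine, measurableEmbedding_halfLine.map_comap]
  infer_instance

lemma sigmaFinite_map_embedding {X Y : Type*} [MeasurableSpace X] [MeasurableSpace Y] {f : X → Y}
    (hf : MeasurableEmbedding f) (μ : Measure X) [SigmaFinite μ] : SigmaFinite (μ.map f) := by
  refine ⟨⟨⟨fun n => f '' spanningSets μ n ∪ (Set.range f)ᶜ, fun _ => trivial, fun n => ?_, ?_⟩⟩⟩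
  · rw [hf.map_apply]
    simpa [Set.preimage_image_eq _ hf.injective] using measure_spanningSets_lt_top μ n
  · rw [← Set.iUnion_union, ← Set.image_iUnion, iUnion_spanningSets, Set.image_univ,
      Set.union_compl_self]

lemma measurableEmbedding_inl {X Y : Type*} [MeasurableSpace X] [MeasurableSpace Y] :
    MeasurableEmbedding (Sum.inl : X → X ⊕ Y) :=
  ⟨Sum.inl_injective, measurable_inl, fun _ h => MeasurableSet.inl_image h⟩

lemma measurableEmbedding_inr {X Y : Type*} [MeasurableSpace X] [MeasurableSpace Y] :
    MeasurableEmbedding (Sum.inr : Y → X ⊕ Y) :=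
  ⟨Sum.inr_injective, measurable_inr, fun _ h => MeasurableSet.inr_image h⟩

namespace Graphon

/-- The infimum over all couplings of the cut norm of the difference of the two pullbacks. -/
def couplingDist (A : Graphon.{u}) (B : Graphon.{v}) : ℝ≥0∞ :=
  ⨅ (ν : Measure (A.S × B.S)) (_ : IsCoupling A.μ B.μ ν),
    cutNorm ν fun p q => A.W p.1 q.1 - B.W p.2 q.2

/-- The function `W`, extended by `0` to the disjoint union of `S` and the half-line. -/
def extW (A : Graphon.{u}) : A.S ⊕ HalfLine → A.S ⊕ HalfLine → ℝ
  | .inl x, .inl y => A.W x y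
  | _, _ => 0

/-- The measure of the disjoint union of `S` and the half-line. -/
def extμ (A : Graphon.{u}) : Measure (A.S ⊕ HalfLine) :=
  A.μ.map Sum.inl + lebHalfLine.map Sum.inr

lemma sigmaFinite_map_inl (A : Graphon.{u}) :
    SigmaFinite (A.μ.map (Sum.inl : A.S → A.S ⊕ HalfLine)) :=
  sigmaFinite_map_embedding measurableEmbedding_inl _

lemma sigmaFinite_map_inr (A : Graphon.{u}) :
    SigmaFinite (lebHalfLine.map (Sum.inr : HalfLine → A.S ⊕ HalfLine)) :=
  sigmaFinite_map_embedding measurableEmbedding_inr _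

instance (A : Graphon.{u}) : SigmaFinite A.extμ := by
  have := A.sigmaFinite_map_inl
  have := A.sigmaFinite_map_inr
  unfold extμ
  infer_instance

lemma extμ_univ (A : Graphon.{u}) : A.extμ Set.univ = ∞ := by
  simp [extμ, Measure.map_apply measurable_inl MeasurableSet.univ,
    Measure.map_apply measurable_inr MeasurableSet.univ, lebHalfLine_univ]

lemma measurable_extW (A : Graphon.{u}) : Measurable (Function.uncurry A.extW) := by
  have hemb : MeasurableEmbedding
      (Prod.map Sum.inl Sum.inl : A.S × A.S → (A.S ⊕ HalfLine) × (A.S ⊕ HalfLine)) :=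
    measurableEmbedding_inl.prodMap measurableEmbedding_inl
  have h : Function.uncurry A.extW = Function.extend
      (Prod.map Sum.inl Sum.inl : A.S × A.S → (A.S ⊕ HalfLine) × (A.S ⊕ HalfLine))
      (Function.uncurry A.W) (fun _ => 0) := by
    ext ⟨x | x, y | y⟩
    · exact (hemb.injective.extend_apply (Function.uncurry A.W) (fun _ => 0) (x, y)).symm
    all_goals
      rw [Function.extend_apply']
      · rfl
      · rintro ⟨⟨a, b⟩, hab⟩
        simp at hab
  rw [h]
  exact hemb.measurable_extend A.measurable measurable_const

lemma integrable_extW (A : Graphon.{u}) :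
    Integrable (Function.uncurry A.extW) (A.extμ.prod A.extμ) := by
  have := A.sigmaFinite_map_inl
  have := A.sigmaFinite_map_inr
  rw [extμ, Measure.prod_add, Measure.add_prod, Measure.add_prod,
    Measure.map_prod_map _ _ measurable_inl measurable_inl,
    Measure.map_prod_map _ _ measurable_inl measurable_inr,
    Measure.map_prod_map _ _ measurable_inr measurable_inl,
    Measure.map_prod_map _ _ measurable_inr measurable_inr]
  refine ((?_ : Integrable _ _).add_measure ?_).add_measure (Integrable.add_measure ?_ ?_)
  all_goals
    rw [integrable_map_measure A.measurable_extW.aestronglyMeasurable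
      (by fun_prop)]
  · exact A.integrable
  all_goals exact integrable_zero _ ℝ _

/-- The trivial extension of a graphon to the disjoint union of `S` and a half-line with Lebesgue
measure, a σ-finite space of infinite mass that extends `S`. -/
def trivialExt (A : Graphon.{u}) : Graphon.{u} where
  S := A.S ⊕ HalfLine
  μ := A.extμ
  mass_ne_zero := by
    simp [extμ_univ]
  W := A.extW
  symm := by
    rintro (x | x) (y | y) <;> first | exact A.symm x y | rfl
  measurable := A.measurable_extW
  integrable := A.integrable_extW

open Classical in
/-- The cut metric: the coupling distance if the total masses agree, and otherwise the coupling
distance of the trivial extensions to spaces of equal (here infinite) mass. -/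
def cutDist (A : Graphon.{u}) (B : Graphon.{v}) : ℝ≥0∞ :=
  if A.μ Set.univ = B.μ Set.univ then couplingDist A B else couplingDist A.trivialExt B.trivialExt

/-- The `L¹` norm of `W`. -/
def norm₁ (A : Graphon.{u}) : ℝ := ∫ p, |A.W p.1 p.2| ∂(A.μ.prod A.μ)

/-- The graphon with the same `W` over the measure multiplied by `c > 0`. -/
def scale (A : Graphon.{u}) (c : ℝ) (hc : 0 < c) : Graphon.{u} where
  S := A.S
  μ := c.toNNReal • A.μ
  mass_ne_zero := by
    have := A.mass_ne_zero
    simp [hc, this]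
  W := A.W
  symm := A.symm
  measurable := A.measurable
  integrable := by
    rw [Measure.prod_smul_left, Measure.prod_smul_right]
    exact (A.integrable.smul_measure_nnreal).smul_measure_nnreal

/-- The zero graphon over the same measure space. -/
def zero (A : Graphon.{u}) : Graphon.{u} where
  S := A.S
  μ := A.μ
  mass_ne_zero := A.mass_ne_zero
  W := fun _ _ => 0
  symm := fun _ _ => rfl
  measurable := measurable_const
  integrable := integrable_zero _ _ _

lemma norm₁_nonneg (A : Graphon.{u}) : 0 ≤ A.norm₁ := integral_nonneg fun _ => abs_nonneg _

open Classical in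
/-- The stretched graphon: the measure is multiplied by `‖W‖₁ ^ (-1/2)`; if `‖W‖₁ = 0` it is the
zero graphon over the same space. -/
def stretch (A : Graphon.{u}) : Graphon.{u} :=
  if h : A.norm₁ = 0 then A.zero
  else A.scale (A.norm₁ ^ (-(1 / 2) : ℝ))
    (Real.rpow_pos_of_pos (lt_of_le_of_ne A.norm₁_nonneg (Ne.symm h)) _)

/-- The stretched cut metric. -/
def stretchedCutDist (A : Graphon.{u}) (B : Graphon.{v}) : ℝ≥0∞ :=
  cutDist A.stretch B.stretch

end Graphon

namespace SimpleGraph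

variable {V : Type*} [Fintype V]

open Classical in
/-- The step function on the half-line of a finite simple graph whose vertices are labelled
`0, …, N - 1` by `σ`: the vertex with label `i` corresponds to the interval `[i, i + 1)`. -/
def stepFun (G : SimpleGraph V) (σ : V ≃ Fin (Fintype.card V)) (x y : HalfLine) : ℝ :=
  if ∃ a b, G.Adj a b ∧ (x : ℝ) ∈ Set.Ico ((σ a : ℕ) : ℝ) ((σ a : ℕ) + 1) ∧
    (y : ℝ) ∈ Set.Ico ((σ b : ℕ) : ℝ) ((σ b : ℕ) + 1) then 1 else 0

lemma stepFun_symm (G : SimpleGraph V) (σ : V ≃ Fin (Fintype.card V)) (x y : HalfLine) :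
    G.stepFun σ x y = G.stepFun σ y x := by
  unfold stepFun
  congr 1
  apply propext
  constructor <;> rintro ⟨a, b, h, hx, hy⟩ <;> exact ⟨b, a, h.symm, hy, hx⟩

lemma measurable_stepFun (G : SimpleGraph V) (σ : V ≃ Fin (Fintype.card V)) :
    Measurable (Function.uncurry (G.stepFun σ)) := by
  refine Measurable.ite ?_ measurable_const measurable_const
  simp only [Set.ofPred_exists]
  refine MeasurableSet.iUnion fun a => MeasurableSet.iUnion fun b => ?_
  refine (MeasurableSet.const _).inter (MeasurableSet.inter ?_ ?_)
  · exact (measurable_subtype_coe.comp measurable_fst) measurableSet_Ico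
  · exact (measurable_subtype_coe.comp measurable_snd) measurableSet_Ico

lemma integrable_stepFun (G : SimpleGraph V) (σ : V ≃ Fin (Fintype.card V)) :
    Integrable (Function.uncurry (G.stepFun σ)) (lebHalfLine.prod lebHalfLine) := by
  set N : ℝ := (Fintype.card V : ℝ)
  set B : Set HalfLine := Subtype.val ⁻¹' Set.Ico 0 N
  have hB : MeasurableSet B := measurable_subtype_coe measurableSet_Ico
  have hBfin : lebHalfLine B < ∞ := by
    rw [lebHalfLine, measurableEmbedding_halfLine.comap_apply]
    refine (measure_mono (Set.image_preimage_subset _ _)).trans_lt ?_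
    simp
  have hlt : ∀ (a : V) (z : ℝ), z ∈ Set.Ico ((σ a : ℕ) : ℝ) ((σ a : ℕ) + 1) → z < N := by
    intro a z hz
    refine hz.2.trans_le ?_
    have h := Nat.succ_le_of_lt (σ a).isLt
    have h' : ((σ a : ℕ) : ℝ) + 1 ≤ (Fintype.card V : ℝ) := by exact_mod_cast h
    exact h'
  refine Integrable.mono' (g := (B ×ˢ B).indicator fun _ => (1 : ℝ)) ?_
    (G.measurable_stepFun σ).aestronglyMeasurable (Eventually.of_forall ?_)
  · refine (integrable_indicator_iff (hB.prod hB)).2 ?_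
    refine integrableOn_const (by rw [Measure.prod_prod]; exact (ENNReal.mul_lt_top hBfin hBfin).ne)
  · rintro ⟨x, y⟩
    by_cases h : ∃ a b, G.Adj a b ∧ (x : ℝ) ∈ Set.Ico ((σ a : ℕ) : ℝ) ((σ a : ℕ) + 1) ∧
        (y : ℝ) ∈ Set.Ico ((σ b : ℕ) : ℝ) ((σ b : ℕ) + 1)
    · have hW : G.stepFun σ x y = 1 := if_pos h
      obtain ⟨a, b, -, hx, hy⟩ := h
      have hm : (x, y) ∈ B ×ˢ B := ⟨⟨x.2, hlt a _ hx⟩, ⟨y.2, hlt b _ hy⟩⟩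
      simp [Function.uncurry, hW, Set.indicator_of_mem hm]
    · have hW : G.stepFun σ x y = 0 := if_neg h
      simp only [Function.uncurry, hW, norm_zero]
      exact Set.indicator_nonneg (fun _ _ => zero_le_one) _

/-- The graphon over the half-line of a finite simple graph with vertices labelled by `σ`, all
vertex weights being `1`. -/
def toGraphon (G : SimpleGraph V) (σ : V ≃ Fin (Fintype.card V)) : Graphon.{0} where
  S := HalfLine
  μ := lebHalfLine
  mass_ne_zero := by
    simp [lebHalfLine_univ]
  W := G.stepFun σ
  symm := G.stepFun_symm σ
  measurable := G.measurable_stepFun σ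
  integrable := G.integrable_stepFun σ

/-- The average degree of a finite graph. -/
def avgDegree (G : SimpleGraph V) [DecidableRel G.Adj] : ℝ :=
  (∑ v, (G.degree v : ℝ)) / Fintype.card V

end SimpleGraph

end

/-! Suppose all average degrees are at most `C`, and write m = |E(G_n)|. Then G_n has at least 2m/C
vertices, and for large n at least m/C of them are not isolated. Stretching multiplies Lebesgue
measure by c = (2m)^(-1/2), so these vertices fill a set of measure at least cm/C, which tends to
infinity, on which every row integral is at least c. This set thus carries cut mass at least c²m/C =
1/(2C), spread thinly over ever larger measure.

A fixed graphon cannot be approximated this way: up to ε its mass lies on the rows of a set D of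
finite measure. A coupling can match only measure μ(D) of the thin rows with D, and this costs only
cμ(D), which tends to 0. The remaining rows are matched with almost no mass, which bounds the cut
distance from below.

The analytic half is `HasHeavyRows.mul_sub_le_of_isCoupling`; the graph side is `norm₁_toGraphon`
and `hasHeavyRows_toGraphon`. -/

namespace IsCoupling

variable {S₁ S₂ : Type*} [MeasurableSpace S₁] [MeasurableSpace S₂]
  {μ₁ : Measure S₁} {μ₂ : Measure S₂} {ν : Measure (S₁ × S₂)}

lemma map_fst (h : IsCoupling μ₁ μ₂ ν) : ν.map Prod.fst = μ₁ := by
  ext U hU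
  rw [Measure.map_apply measurable_fst hU, ← h.1 U hU, Set.prod_univ]

lemma map_snd (h : IsCoupling μ₁ μ₂ ν) : ν.map Prod.snd = μ₂ := by
  ext U hU
  rw [Measure.map_apply measurable_snd hU, ← h.2 U hU, Set.univ_prod]

lemma sigmaFinite [SigmaFinite μ₁] (h : IsCoupling μ₁ μ₂ ν) : SigmaFinite ν :=
  SigmaFinite.of_map ν measurable_fst.aemeasurable (by rw [h.map_fst]; infer_instance)

lemma measurePreserving_prodMap_fst [SigmaFinite μ₁] (h : IsCoupling μ₁ μ₂ ν) :
    MeasurePreserving (Prod.map Prod.fst Prod.fst) (ν.prod ν) (μ₁.prod μ₁) := by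
  have := h.sigmaFinite
  exact MeasurePreserving.prod ⟨measurable_fst, h.map_fst⟩ ⟨measurable_fst, h.map_fst⟩

lemma measurePreserving_prodMap_snd [SigmaFinite μ₁] [SigmaFinite μ₂] (h : IsCoupling μ₁ μ₂ ν) :
    MeasurePreserving (Prod.map Prod.snd Prod.snd) (ν.prod ν) (μ₂.prod μ₂) := by
  have := h.sigmaFinite
  exact MeasurePreserving.prod ⟨measurable_snd, h.map_snd⟩ ⟨measurable_snd, h.map_snd⟩

end IsCoupling

lemma abs_setIntegral_le_of_cutNorm_lt {T : Type*} [MeasurableSpace T] {μ : Measure T}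
    {F : T → T → ℝ} {δ : ℝ} (h : cutNorm μ F < ENNReal.ofReal δ) {U V : Set T}
    (hU : MeasurableSet U) (hV : MeasurableSet V) :
    |∫ p in U ×ˢ V, F p.1 p.2 ∂(μ.prod μ)| ≤ δ := by
  have hle : ENNReal.ofReal |∫ p in U ×ˢ V, F p.1 p.2 ∂(μ.prod μ)| ≤ cutNorm μ F :=
    le_iSup_of_le U (le_iSup_of_le V (le_iSup_of_le hU (le_iSup_of_le hV le_rfl)))
  exact ((ENNReal.ofReal_lt_ofReal_iff').1 (hle.trans_lt h)).1.le

/-! ### Heavy rows under couplings, trivial extension and stretching -/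

namespace Graphon

/-- The graphon has row integrals at least `r` on a set of measure `t`. -/
def HasHeavyRows (A : Graphon.{u}) (r t : ℝ) : Prop :=
  ∃ N : Set A.S, MeasurableSet N ∧ A.μ N = ENNReal.ofReal t ∧ ∀ x ∈ N, r ≤ ∫ y, A.W x y ∂A.μ

/-- A graphon is concentrated, up to a small part, on the rows of a set of finite measure. -/
lemma exists_setIntegral_compl_prod_univ_lt (B : Graphon.{u}) {ε : ℝ} (hε : 0 < ε) :
    ∃ D : Set B.S, MeasurableSet D ∧ B.μ D < ∞ ∧
      ∫ p in Dᶜ ×ˢ Set.univ, |B.W p.1 p.2| ∂(B.μ.prod B.μ) < ε := by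
  have hmeas : ∀ n, MeasurableSet ((spanningSets B.μ n)ᶜ ×ˢ (Set.univ : Set B.S)) := fun n =>
    (measurableSet_spanningSets B.μ n).compl.prod .univ
  have h := tendsto_setIntegral_of_antitone (μ := B.μ.prod B.μ)
    (f := fun p => |B.W p.1 p.2|) (s := fun n => (spanningSets B.μ n)ᶜ ×ˢ (Set.univ : Set B.S))
    hmeas
    (fun i j hij => Set.prod_mono (Set.compl_subset_compl.2 (monotone_spanningSets B.μ hij)) le_rfl)
    ⟨0, (B.integrable.abs).integrableOn⟩
  -- The complements of an exhaustion by sets of finite measure decrease to the empty set, so the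
  -- mass on their rows tends to 0.
  have he : ⋂ n, (spanningSets B.μ n)ᶜ ×ˢ (Set.univ : Set B.S) = ∅ := by
    refine Set.eq_empty_of_forall_notMem fun p hp => ?_
    obtain ⟨n, hn⟩ := Set.mem_iUnion.1 ((iUnion_spanningSets B.μ).symm ▸ Set.mem_univ p.1)
    exact (Set.mem_iInter.1 hp n).1 hn
  rw [he, setIntegral_empty] at h
  obtain ⟨n, hn⟩ := (h.eventually (gt_mem_nhds hε)).exists
  exact ⟨_, measurableSet_spanningSets B.μ n, measure_spanningSets_lt_top B.μ n, hn⟩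

/-- The cut norm is tested on `U ×ˢ univ`, where `U` consists of the heavy rows of `A` that `ν`
matches with points outside `D`. There `A` contributes at least `r * ν.real U`, and `B` at most `ε`.
-/
lemma HasHeavyRows.mul_sub_le_of_isCoupling {A : Graphon.{u}} {B : Graphon.{v}} {r t δ ε : ℝ}
    (hA : A.HasHeavyRows r t) (hr : 0 ≤ r) {D : Set B.S} (hD : MeasurableSet D)
    (hDfin : B.μ D < ∞)
    (hDε : ∫ p in Dᶜ ×ˢ Set.univ, |B.W p.1 p.2| ∂(B.μ.prod B.μ) ≤ ε)
    {ν : Measure (A.S × B.S)} (hν : IsCoupling A.μ B.μ ν)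
    (hcut : cutNorm ν (fun p q => A.W p.1 q.1 - B.W p.2 q.2) < ENNReal.ofReal δ) :
    r * (t - B.μ.real D) ≤ δ + ε := by
  obtain ⟨N, hN, hNt, hNr⟩ := hA
  have := hν.sigmaFinite
  have hPA := hν.measurePreserving_prodMap_fst
  have hPB := hν.measurePreserving_prodMap_snd
  set U : Set (A.S × B.S) := N ×ˢ Dᶜ with hU
  have hUm : MeasurableSet U := hN.prod hD.compl
  have hUN : ν U ≤ A.μ N := by
    rw [← hν.1 N hN]
    exact measure_mono (Set.prod_mono le_rfl (Set.subset_univ _))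
  have hUfin : ν U < ∞ := hUN.trans_lt (by rw [hNt]; exact ENNReal.ofReal_lt_top)
  have hIA : Integrable (fun p : (A.S × B.S) × (A.S × B.S) => A.W p.1.1 p.2.1) (ν.prod ν) :=
    hPA.integrable_comp_of_integrable A.integrable
  have hIB : Integrable (fun p : (A.S × B.S) × (A.S × B.S) => B.W p.1.2 p.2.2) (ν.prod ν) :=
    hPB.integrable_comp_of_integrable B.integrable
  have hmass : t - B.μ.real D ≤ ν.real U := by
    -- `N ×ˢ univ` is covered by `U` and `univ ×ˢ D`, whose measures are controlled by the
    -- marginals.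
    have h : A.μ N ≤ ν U + B.μ D := by
      rw [← hν.1 N hN, ← hν.2 D hD]
      refine (measure_mono ?_).trans (measure_union_le _ _)
      rintro ⟨x, y⟩ ⟨hx, -⟩
      by_cases hy : y ∈ D
      · exact Or.inr ⟨trivial, hy⟩
      · exact Or.inl ⟨hx, hy⟩
    rw [hNt, ENNReal.ofReal_le_iff_le_toReal (by finiteness),
      ENNReal.toReal_add hUfin.ne hDfin.ne] at h
    simp only [measureReal_def]
    linarith
  have hrow : ∀ x : A.S, ∫ q, A.W x q.1 ∂ν = ∫ y, A.W x y ∂A.μ := by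
    intro x
    rw [← hν.map_fst, integral_map measurable_fst.aemeasurable]
    exact (A.measurable.comp measurable_prodMk_left).aestronglyMeasurable
  have hlowA : r * ν.real U ≤ ∫ p in U ×ˢ Set.univ, A.W p.1.1 p.2.1 ∂(ν.prod ν) := by
    rw [setIntegral_prod _ hIA.integrableOn]
    simp only [Measure.restrict_univ]
    refine setIntegral_ge_of_const_le_real hUm hUfin.ne ?_ hIA.integral_prod_left.integrableOn
    rintro ⟨x, y⟩ ⟨hx, -⟩
    simpa only [hrow] using hNr x hx
  have hupB : ∫ p in U ×ˢ Set.univ, B.W p.1.2 p.2.2 ∂(ν.prod ν) ≤ ε := by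
    have h1 : |∫ p in U ×ˢ Set.univ, B.W p.1.2 p.2.2 ∂(ν.prod ν)| ≤
        ∫ p in U ×ˢ Set.univ, |B.W p.1.2 p.2.2| ∂(ν.prod ν) := abs_integral_le_integral_abs
    have h2 : ∫ p in U ×ˢ Set.univ, |B.W p.1.2 p.2.2| ∂(ν.prod ν) ≤
        ∫ p in Prod.map Prod.snd Prod.snd ⁻¹' (Dᶜ ×ˢ (Set.univ : Set B.S)), |B.W p.1.2 p.2.2|
          ∂(ν.prod ν) := by
      refine setIntegral_mono_set hIB.abs.integrableOn (ae_of_all _ fun _ => abs_nonneg _)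
        (LE.le.eventuallyLE ?_)
      rintro ⟨⟨a, b⟩, c, d⟩ ⟨⟨-, hb⟩, -⟩
      exact ⟨hb, trivial⟩
    have h3 : ∫ p in Prod.map Prod.snd Prod.snd ⁻¹' (Dᶜ ×ˢ (Set.univ : Set B.S)),
        |B.W p.1.2 p.2.2| ∂(ν.prod ν) =
        ∫ p in Dᶜ ×ˢ Set.univ, |B.W p.1 p.2| ∂(B.μ.prod B.μ) := by
      rw [← hPB.map_eq, setIntegral_map (hD.compl.prod .univ) _ hPB.measurable.aemeasurable]
      · rfl
      · rw [hPB.map_eq]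
        exact B.integrable.abs.aestronglyMeasurable
    linarith [le_abs_self (∫ p in U ×ˢ Set.univ, B.W p.1.2 p.2.2 ∂(ν.prod ν))]
  have hd := abs_setIntegral_le_of_cutNorm_lt hcut hUm MeasurableSet.univ
  rw [integral_sub hIA.integrableOn hIB.integrableOn] at hd
  have hm := mul_le_mul_of_nonneg_left hmass hr
  linarith [(abs_le.1 hd).2]

/-- Graphons close to `B` have few heavy rows. -/
lemma exists_bound_of_couplingDist_lt (B : Graphon.{v}) {ε : ℝ} (hε : 0 < ε) :
    ∃ M : ℝ, ∀ (A : Graphon.{u}) (r t δ : ℝ), 0 ≤ r → A.HasHeavyRows r t →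
      couplingDist A B < ENNReal.ofReal δ → r * (t - M) ≤ δ + ε := by
  obtain ⟨D, hD, hDfin, hDε⟩ := B.exists_setIntegral_compl_prod_univ_lt hε
  -- The bound `M` depends only on `B` and `ε`, hence serves a whole sequence of graphons `A`.
  refine ⟨B.μ.real D, fun A r t δ hr hA hdist => ?_⟩
  simp only [couplingDist, iInf_lt_iff] at hdist
  obtain ⟨ν, hν, hcut⟩ := hdist
  exact hA.mul_sub_le_of_isCoupling hr hD hDfin hDε.le hν hcut

lemma integral_extμ_inl (A : Graphon.{u}) (x : A.S) :
    ∫ y, A.extW (.inl x) y ∂A.extμ = ∫ y, A.W x y ∂A.μ := by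
  have hr : ∫ y, A.extW (.inl x) y ∂(lebHalfLine.map Sum.inr) = 0 := by
    rw [measurableEmbedding_inr.integral_map]
    exact integral_zero _ _
  have hri : Integrable (A.extW (.inl x)) (lebHalfLine.map Sum.inr) := by
    rw [measurableEmbedding_inr.integrable_map_iff]
    exact integrable_zero _ _ _
  have hl : ∫ y, A.extW (.inl x) y ∂(A.μ.map Sum.inl) = ∫ y, A.W x y ∂A.μ := by
    rw [measurableEmbedding_inl.integral_map]
    rfl
  -- A single row need not be integrable; in that case both integrals take the default value 0.
  by_cases h : Integrable (A.extW (.inl x)) (A.μ.map Sum.inl)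
  · rw [extμ, integral_add_measure h hri, hl, hr, add_zero]
  · rw [← hl, integral_undef h, extμ, integral_undef]
    exact fun h' => h h'.left_of_add_measure

lemma HasHeavyRows.trivialExt {A : Graphon.{u}} {r t : ℝ} (h : A.HasHeavyRows r t) :
    A.trivialExt.HasHeavyRows r t := by
  obtain ⟨N, hN, hNt, hNr⟩ := h
  refine ⟨(Sum.inl '' N : Set (A.S ⊕ HalfLine)), measurableEmbedding_inl.measurableSet_image.2 hN,
    ?_, ?_⟩
  · change A.extμ _ = _
    rw [extμ, Measure.add_apply, measurableEmbedding_inl.map_apply,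
      measurableEmbedding_inr.map_apply, Set.preimage_image_eq _ Sum.inl_injective, hNt]
    simp
  · rintro _ ⟨x, hx, rfl⟩
    exact (hNr x hx).trans_eq (A.integral_extμ_inl x).symm

lemma exists_bound_of_cutDist_lt (B : Graphon.{v}) {ε : ℝ} (hε : 0 < ε) :
    ∃ M : ℝ, ∀ (A : Graphon.{u}) (r t δ : ℝ), 0 ≤ r → A.HasHeavyRows r t →
      cutDist A B < ENNReal.ofReal δ → r * (t - M) ≤ δ + ε := by
  obtain ⟨M₁, h₁⟩ := B.exists_bound_of_couplingDist_lt hε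
  obtain ⟨M₂, h₂⟩ := B.trivialExt.exists_bound_of_couplingDist_lt hε
  -- One constant has to cover both branches of `cutDist`; enlarging `M` only weakens the bound,
  -- since `0 ≤ r`.
  refine ⟨max M₁ M₂, fun A r t δ hr hA hdist => ?_⟩
  rw [cutDist] at hdist
  split_ifs at hdist
  · refine le_trans ?_ (h₁ A r t δ hr hA hdist)
    gcongr
    exact le_max_left _ _
  · refine le_trans ?_ (h₂ A.trivialExt r t δ hr hA.trivialExt hdist)
    gcongr
    exact le_max_right _ _

/-- Scaling the measure by a factor scales both the row integrals and the measure of the set of rows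
by it, so `r * t` gains its square, the inverse of the norm. -/
lemma HasHeavyRows.stretch {A : Graphon.{u}} (hA : A.norm₁ ≠ 0) {r t : ℝ}
    (h : A.HasHeavyRows r t) :
    A.stretch.HasHeavyRows (A.norm₁ ^ (-(1 / 2) : ℝ) * r) (A.norm₁ ^ (-(1 / 2) : ℝ) * t) := by
  obtain ⟨N, hN, hNt, hNr⟩ := h
  have hc : 0 ≤ A.norm₁ ^ (-(1 / 2) : ℝ) := Real.rpow_nonneg A.norm₁_nonneg _
  rw [Graphon.stretch, dif_neg hA]
  refine ⟨N, hN, ?_, fun x hx => ?_⟩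
  · change ((A.norm₁ ^ (-(1 / 2) : ℝ)).toNNReal • A.μ) N = _
    rw [Measure.smul_apply, hNt, ENNReal.ofReal_mul hc]
    rfl
  · change _ ≤ ∫ y, A.W x y ∂((A.norm₁ ^ (-(1 / 2) : ℝ)).toNNReal • A.μ)
    rw [integral_smul_nnreal_measure, NNReal.smul_def, Real.coe_toNNReal _ hc, smul_eq_mul]
    exact mul_le_mul_of_nonneg_left (hNr x hx) hc

end Graphon

/-! ### Norm and heavy rows of the graphon of a graph -/

/-- The interval `[i, i + 1)` of the half-line. -/
def HalfLine.cell (i : ℕ) : Set HalfLine := Subtype.val ⁻¹' Set.Ico (i : ℝ) (i + 1)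

namespace HalfLine

lemma measurableSet_cell (i : ℕ) : MeasurableSet (cell i) :=
  measurable_subtype_coe measurableSet_Ico

lemma lebHalfLine_cell (i : ℕ) : lebHalfLine (cell i) = 1 := by
  have hsub : Set.Ico (i : ℝ) (i + 1) ⊆ Set.Ici 0 := fun x hx => (Nat.cast_nonneg i).trans hx.1
  rw [lebHalfLine, measurableEmbedding_halfLine.comap_apply, cell,
    Set.image_preimage_eq_inter_range, Subtype.range_coe, Set.inter_eq_left.2 hsub]
  simp

lemma eq_of_mem_cell {i j : ℕ} {x : HalfLine} (hi : x ∈ cell i) (hj : x ∈ cell j) : i = j := by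
  obtain ⟨h₁, h₂⟩ := hi
  obtain ⟨h₃, h₄⟩ := hj
  have h : (i : ℝ) < j + 1 := h₁.trans_lt h₄
  have h' : (j : ℝ) < i + 1 := h₃.trans_lt h₂
  norm_cast at h h'
  omega

end HalfLine

namespace SimpleGraph

open HalfLine

variable {V : Type*} [Fintype V]

/-- The step function is the indicator of a disjoint union of unit squares, one for each ordered
pair of adjacent vertices. -/
lemma norm₁_toGraphon (G : SimpleGraph V) [DecidableRel G.Adj] (σ : V ≃ Fin (Fintype.card V)) :
    (G.toGraphon σ).norm₁ = ∑ v, (G.degree v : ℝ) := by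
  classical
  set P : Finset (V × V) := {p | G.Adj p.1 p.2} with hP
  set R : V × V → Set (HalfLine × HalfLine) := fun p => cell (σ p.1) ×ˢ cell (σ p.2) with hR
  have hRm : ∀ p, MeasurableSet (R p) := fun p =>
    (measurableSet_cell _).prod (measurableSet_cell _)
  have hEm : MeasurableSet (⋃ p ∈ P, R p) := P.measurableSet_biUnion fun p _ => hRm p
  have hfun : (fun q : HalfLine × HalfLine => |G.stepFun σ q.1 q.2|) =
      (⋃ p ∈ P, R p).indicator 1 := by
    ext ⟨x, y⟩
    by_cases h : ∃ a b, G.Adj a b ∧ (x : ℝ) ∈ Set.Ico ((σ a : ℕ) : ℝ) ((σ a : ℕ) + 1) ∧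
        (y : ℝ) ∈ Set.Ico ((σ b : ℕ) : ℝ) ((σ b : ℕ) + 1)
    · have hW : G.stepFun σ x y = 1 := if_pos h
      obtain ⟨a, b, hab, hx, hy⟩ := h
      have hm : (x, y) ∈ ⋃ p ∈ P, R p := Set.mem_biUnion (x := (a, b)) (by simpa [hP]) ⟨hx, hy⟩
      simp [hW, Set.indicator_of_mem hm]
    · have hW : G.stepFun σ x y = 0 := if_neg h
      rw [Set.indicator_of_notMem, hW, abs_zero]
      intro hm
      obtain ⟨⟨a, b⟩, hab, hx, hy⟩ := Set.mem_iUnion₂.1 hm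
      exact h ⟨a, b, by simpa [hP] using hab, hx, hy⟩
  have hdisj : Set.PairwiseDisjoint (P : Set (V × V)) R := by
    rintro ⟨a, b⟩ - ⟨c, d⟩ - hne
    refine Set.disjoint_left.2 ?_
    rintro ⟨x, y⟩ ⟨hx, hy⟩ ⟨hx', hy'⟩
    refine hne (Prod.ext ?_ ?_)
    · exact σ.injective (Fin.ext (eq_of_mem_cell hx hx'))
    · exact σ.injective (Fin.ext (eq_of_mem_cell hy hy'))
  have hvol : (lebHalfLine.prod lebHalfLine) (⋃ p ∈ P, R p) = P.card := by
    rw [measure_biUnion_finset hdisj fun p _ => hRm p]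
    simp [hR, Measure.prod_prod, lebHalfLine_cell]
  change ∫ q : HalfLine × HalfLine, |G.stepFun σ q.1 q.2| ∂(lebHalfLine.prod lebHalfLine) = _
  rw [hfun, integral_indicator_one hEm, measureReal_def, hvol, ENNReal.toReal_natCast]
  have hcard : P.card = ∑ v, G.degree v := by
    rw [hP, Finset.card_filter, Fintype.sum_prod_type]
    refine Finset.sum_congr rfl fun v _ => ?_
    rw [← Finset.card_filter, ← card_neighborFinset_eq_degree, neighborFinset_eq_filter]
  rw [hcard, Nat.cast_sum]

lemma one_le_integral_stepFun (G : SimpleGraph V) (σ : V ≃ Fin (Fintype.card V)) {a : V}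
    (ha : ¬ G.IsIsolated a) {x : HalfLine} (hx : x ∈ cell (σ a)) :
    1 ≤ ∫ y, G.stepFun σ x y ∂lebHalfLine := by
  obtain ⟨b, hab⟩ : ∃ b, G.Adj a b := by
    by_contra! h
    exact ha h
  have hle : ∀ y, (cell (σ b)).indicator (fun _ => (1 : ℝ)) y ≤ G.stepFun σ x y := by
    intro y
    by_cases hy : y ∈ cell (σ b)
    · rw [Set.indicator_of_mem hy]
      exact (if_pos (⟨a, b, hab, hx, hy⟩ : ∃ a b, G.Adj a b ∧ _)).ge
    · rw [Set.indicator_of_notMem hy, stepFun]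
      split_ifs <;> norm_num
  -- Each row is dominated by the indicator of the finite union of all cells; monotonicity of the
  -- integral needs this integrability.
  have hint : Integrable (G.stepFun σ x) lebHalfLine := by
    refine Integrable.mono' (g := (⋃ c, cell (σ c)).indicator fun _ => (1 : ℝ)) ?_
      ((G.measurable_stepFun σ).comp measurable_prodMk_left).aestronglyMeasurable
      (ae_of_all _ fun y => ?_)
    · refine (integrable_indicator_iff (.iUnion fun c => measurableSet_cell _)).2
        (integrableOn_const (ne_of_lt ?_))
      refine (measure_iUnion_le _).trans_lt ?_
      simp [lebHalfLine_cell]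
    · by_cases h : ∃ a b, G.Adj a b ∧ (x : ℝ) ∈ Set.Ico ((σ a : ℕ) : ℝ) ((σ a : ℕ) + 1) ∧
          (y : ℝ) ∈ Set.Ico ((σ b : ℕ) : ℝ) ((σ b : ℕ) + 1)
      · have hW : G.stepFun σ x y = 1 := if_pos h
        obtain ⟨c, d, -, -, hy⟩ := h
        have hm : y ∈ ⋃ c, cell (σ c) := Set.mem_iUnion.2 ⟨d, hy⟩
        simp [hW, Set.indicator_of_mem hm]
      · have hW : G.stepFun σ x y = 0 := if_neg h
        rw [hW, norm_zero]
        exact Set.indicator_nonneg (fun _ _ => zero_le_one) _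
  have hone : ∫ y, (cell (σ b)).indicator (fun _ => (1 : ℝ)) y ∂lebHalfLine = 1 := by
    rw [integral_indicator (measurableSet_cell _), setIntegral_const, measureReal_def,
      lebHalfLine_cell]
    simp
  refine hone.symm.le.trans (integral_mono ?_ hint hle)
  exact (integrable_indicator_iff (measurableSet_cell _)).2
    (integrableOn_const (by simp [lebHalfLine_cell]))

lemma hasHeavyRows_toGraphon (G : SimpleGraph V) (σ : V ≃ Fin (Fintype.card V)) :
    (G.toGraphon σ).HasHeavyRows 1
      (Fintype.card V - ({x | G.IsIsolated x} : Set V).ncard : ℝ) := by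
  classical
  set Q : Finset V := {a | ¬ G.IsIsolated a} with hQ
  refine ⟨(⋃ a ∈ Q, cell (σ a) : Set HalfLine),
    Q.measurableSet_biUnion fun a _ => measurableSet_cell _, ?_, ?_⟩
  · have hdisj : Set.PairwiseDisjoint (Q : Set V) fun a => cell (σ a) := by
      intro a _ b _ hne
      exact Set.disjoint_left.2 fun x hx hx' =>
        hne (σ.injective (Fin.ext (eq_of_mem_cell hx hx')))
    have hcard : (Fintype.card V : ℝ) - ({x | G.IsIsolated x} : Set V).ncard = Q.card := by
      have h := Finset.card_filter_add_card_filter_not (s := (Finset.univ : Finset V))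
        (fun a => G.IsIsolated a)
      have h' : ({x | G.IsIsolated x} : Set V).ncard =
          (Finset.univ.filter fun a => G.IsIsolated a).card := by
        rw [← Set.ncard_coe_finset]
        simp
      rw [h', ← Finset.card_univ, ← h]
      push_cast
      ring
    change lebHalfLine _ = _
    rw [measure_biUnion_finset hdisj fun a _ => measurableSet_cell _, hcard]
    simp [lebHalfLine_cell]
  · intro x hx
    obtain ⟨a, ha, hxa⟩ := Set.mem_iUnion₂.1 hx
    exact G.one_le_integral_stepFun σ (by simpa [hQ] using ha) hxa

end SimpleGraph

/-! ### Contradiction from bounded average degree -/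

theorem mainTheorem12 {V : ℕ → Type v} [∀ n, Fintype (V n)]
    (G : ∀ n, SimpleGraph (V n)) [∀ n, DecidableRel (G n).Adj]
    (σ : ∀ n, V n ≃ Fin (Fintype.card (V n)))
    (hiso : (fun n => (({x | (G n).IsIsolated x} : Set (V n)).ncard : ℝ)) =o[atTop]
      fun n => ((G n).edgeFinset.card : ℝ))
    (hedges : Tendsto (fun n => (G n).edgeFinset.card) atTop atTop)
    (hconv : ∃ A : Graphon.{u},
      Tendsto (fun n => Graphon.stretchedCutDist ((G n).toGraphon (σ n)) A) atTop (𝓝 0)) :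
    ¬ BddAbove (Set.range fun n => (G n).avgDegree) := by
  rintro ⟨C₀, hC₀⟩
  obtain ⟨A, hA⟩ := hconv
  obtain ⟨C, hC, hdeg⟩ : ∃ C : ℝ, 0 < C ∧ ∀ n, (G n).avgDegree ≤ C :=
    ⟨max C₀ 1, by positivity, fun n => (hC₀ ⟨n, rfl⟩).trans (le_max_left _ _)⟩
  -- Chosen so that the non-isolated vertices carry at least 1/(2C) = 4η, against a total error of
  -- less than 3η.
  set η : ℝ := 1 / (8 * C) with hη
  have hηpos : 0 < η := by positivity
  obtain ⟨M, hM⟩ := A.stretch.exists_bound_of_cutDist_lt hηpos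
  have hmtop : Tendsto (fun n => 2 * ((G n).edgeFinset.card : ℝ)) atTop atTop :=
    (tendsto_natCast_atTop_atTop.comp hedges).const_mul_atTop two_pos
  have hctop : Tendsto (fun n => (2 * ((G n).edgeFinset.card : ℝ)) ^ (-(1 / 2) : ℝ) * M) atTop
      (𝓝 0) := by
    simpa using ((tendsto_rpow_neg_atTop (by norm_num : (0 : ℝ) < 1 / 2)).comp hmtop).mul_const M
  have hdist := hA.eventually (gt_mem_nhds (ENNReal.ofReal_pos.2 hηpos))
  obtain ⟨n, hn, hcM, hison, hpos⟩ := (hdist.and ((hctop.eventually (gt_mem_nhds hηpos)).and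
    ((hiso.bound (by positivity : 0 < 1 / C)).and (hmtop.eventually_gt_atTop 0)))).exists
  set m : ℝ := ((G n).edgeFinset.card : ℝ) with hm
  set k : ℝ := Fintype.card (V n) - ({x | (G n).IsIsolated x} : Set (V n)).ncard with hk
  have hsum : ∑ v, ((G n).degree v : ℝ) = 2 * m := by
    rw [hm]
    exact_mod_cast (G n).sum_degrees_eq_twice_card_edges
  have hnorm : ((G n).toGraphon (σ n)).norm₁ = 2 * m := by
    rw [SimpleGraph.norm₁_toGraphon, hsum]
  have hheavy := ((G n).hasHeavyRows_toGraphon (σ n)).stretch (by rw [hnorm]; exact hpos.ne')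
  rw [hnorm, ← hk] at hheavy
  set c : ℝ := (2 * m) ^ (-(1 / 2) : ℝ) with hc
  have hcpos : 0 < c := Real.rpow_pos_of_pos hpos _
  have hcc : c * c = 1 / (2 * m) := by
    rw [hc, ← Real.rpow_add hpos]
    norm_num [Real.rpow_neg_one]
  have hbound := hM _ _ _ η (by positivity) hheavy hn
  have hcard : 2 * m ≤ C * Fintype.card (V n) := by
    have h := hdeg n
    rw [SimpleGraph.avgDegree, hsum] at h
    -- With no vertices the average degree is 0/0 = 0 and gives no information, but the degree sum
    -- is empty.
    rcases (Nat.cast_nonneg (α := ℝ) (Fintype.card (V n))).eq_or_lt with h0 | h0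
    · have : IsEmpty (V n) := Fintype.card_eq_zero_iff.1 (by exact_mod_cast h0.symm)
      simp [← hsum]
    · exact (div_le_iff₀ h0).1 h
  have hmpos : 0 < m := by linarith
  have hkm : m / C ≤ k := by
    rw [Real.norm_natCast, Real.norm_of_nonneg hmpos.le] at hison
    have h : 2 * m / C ≤ Fintype.card (V n) := by
      rw [div_le_iff₀ hC]
      linarith
    -- Half of the 2m/C vertices are given up to cover the isolated ones, at most m/C in number.
    have h' : 2 * m / C = 1 / C * m + m / C := by ring
    rw [hk]
    linarith
  have hkc : 4 * η ≤ c * c * k := by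
    calc 4 * η = 1 / (2 * m) * (m / C) := by rw [hη]; field_simp; norm_num
      _ ≤ c * c * k := by rw [hcc]; gcongr
  -- The left side of `hbound` exceeds 4η - η, while its right side is η + η.
  linarith [show c * 1 * (c * k - M) = c * c * k - c * M by ring]
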